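/- Let $T$ be a compact topological space, let $d, d'$ be two metrics on $T$, each inducing the topology of $T$, and let $\mu,\mu'$ be Radon measures on the Borel $\sigma$-algebra of $T$, both strictly positive (every nonempty open set has positive measure), with $\mu$ absolutely continuous with respect to $\mu'$. For the metric measure space $X=(T,d,\mu)$, the distance kernel operator on the real Hilbert space $L^2(\mu)$ is $$(Df)(x)=\int_T f(y)\,d(x,y)\,d\mu(y).$$ Choose an orthonormal basis of $L^2(\mu)$ consisting of eigenfunctions of $D$, drop its members with eigenvalue $0$, and list the others as $\phi_1,\phi_2,\dots$, with eigenvalues $\lambda_1,\lambda_2,\dots$ (repeated according to multiplicity), so that $|\lambda_1|\ge|\lambda_2|\ge\cdots$, positive eigenvalues being listed first among those of equal absolute value; here each $\phi_i$ is the continuous representative, so that $D\phi_i=\lambda_i\phi_i$ at every point. If there are only finitely many nonzero eigenvalues, fill up the list with $\lambda_i=0$ and $\phi_i=0$. A distance kernel embedding of $X$ is the map $$\Phi_X:T\to\mathbb{C}^\infty,\qquad \Phi_X(x)=\bigl(\sqrt{\lambda_i}\,\phi_i(x)\bigr)_{i\ge 1},$$ where the square root of a negative number is the one with positive imaginary part.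 Distance kernel embeddings of $X'=(T,d',\mu')$ are defined in the same way from $d'$ and $\mu'$. If, for some choices of the eigenbases, $\Phi_X=\Phi_{X'}$ as maps $T\to\mathbb{C}^\infty$, then $d=d'$. -/

import Mathlib

open MeasureTheory

noncomputable section

/-- The distance kernel operator `(D f)(x) = ∫ f(y) d(x,y) dμ(y)` of a metric measure space.
The right-hand side makes sense at every point `x` and depends only on the `μ`-a.e. class of `f`. -/
def distKernelOp {T : Type*} [MeasurableSpace T] (d : MetricSpace T) (μ : Measure T)
    (f : T → ℝ) (x : T) : ℝ :=
  ∫ y, f y * d.dist x y ∂μ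

/-- The square root of a real number with the convention that the square root of a negative
number has positive imaginary part. -/
def realCSqrt (r : ℝ) : ℂ :=
  if 0 ≤ r then (Real.sqrt r : ℂ) else (Real.sqrt (-r) : ℂ) * Complex.I

/-- `lam n`, `φ n` (`n = 0, 1, 2, …`) is an admissible listing of the eigenvalues and eigenfunctions
of the distance kernel operator `D` of `(T, d, μ)`: the real Hilbert space `L²(μ)` has an
orthonormal basis of eigenfunctions of `D` (with repeated eigenvalues allowed), the `φ n` with
`lam n ≠ 0` are exactly the members with a nonzero eigenvalue, in decreasing order of the absolute
value of the eigenvalue and with positive eigenvalues first in case of a tie; the members in the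
zero eigenspace are dropped and, if necessary, the list is filled up with the zero function.
The choice of the basis (in particular of the signs of the `φ n`) is not unique. -/
structure IsDistKernelEigensystem {T : Type*} [MeasurableSpace T] (d : MetricSpace T)
    (μ : Measure T) (lam : ℕ → ℝ) (φ : ℕ → T → ℝ) : Prop where
  /-- `D φₙ = λₙ φₙ`, at every point: this fixes the continuous representative of an eigenfunction
  with nonzero eigenvalue. -/
  eigen : ∀ n x, distKernelOp d μ (φ n) x = lam n * φ n x
  abs_antitone : ∀ m n, m ≤ n → |lam n| ≤ |lam m|
  pos_first : ∀ m n, m ≤ n → |lam n| = |lam m| → lam n ≤ lam m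
  zero_of_eq_zero : ∀ n, lam n = 0 → φ n = 0
  /-- The `φ n` with `lam n ≠ 0`, together with a family `K` in the kernel of `D`, form an
  orthonormal basis of `L²(μ)`. -/
  basis : ∃ (K : Set (Lp ℝ 2 μ)) (b : HilbertBasis ({n : ℕ // lam n ≠ 0} ⊕ K) ℝ (Lp ℝ 2 μ)),
    (∀ n : {n : ℕ // lam n ≠ 0}, (b (Sum.inl n) : T → ℝ) =ᵐ[μ] φ n) ∧
    ∀ k : K, distKernelOp d μ (b (Sum.inr k)) =ᵐ[μ] 0

/-- `Φ : T → ℂ^∞` is a distance kernel embedding of the metric measure space `(T, d, μ)`: its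
coordinates are `αₙ = √λₙ φₙ` for an admissible listing of eigenvalues and eigenfunctions. -/
def IsDistKernelEmbedding {T : Type*} [MeasurableSpace T] (d : MetricSpace T) (μ : Measure T)
    (Φ : T → ℕ → ℂ) : Prop :=
  ∃ (lam : ℕ → ℝ) (φ : ℕ → T → ℝ), IsDistKernelEigensystem d μ lam φ ∧
    ∀ x n, Φ x n = realCSqrt (lam n) * (φ n x : ℂ)

end

open Filter Topology

/-! The products of coordinates of the embedding at `x` and `y` are `λₙ φₙ(x) φₙ(y)`, the terms of
the eigenfunction expansion of `d(x,·)`. For every `x` this expansion converges in `L²(μ)`, so equal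
embeddings give partial sums tending to `d(x,·)` in `μ`-measure and to `d'(x,·)` in `μ'`-measure.
Since `μ ≪ μ'`, a common subsequence has both limits `μ`-a.e.; continuity and full support then give
equality everywhere. -/

lemma continuous_metric_dist {T : Type*} [t : TopologicalSpace T] (d : MetricSpace T)
    (hd : d.toPseudoMetricSpace.toUniformSpace.toTopologicalSpace = t) :
    Continuous fun p : T × T => d.dist p.1 p.2 := by
  subst hd
  exact continuous_dist

lemma realCSqrt_mul_self (r : ℝ) : realCSqrt r * realCSqrt r = r := by
  unfold realCSqrt
  split_ifs with h
  · rw [← Complex.ofReal_mul, Real.mul_self_sqrt h]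
  · have h' : 0 ≤ -r := by linarith
    rw [mul_mul_mul_comm, Complex.I_mul_I, ← Complex.ofReal_mul, Real.mul_self_sqrt h']
    push_cast
    ring

section Expansion

variable {T : Type*} [t : TopologicalSpace T] [CompactSpace T] [MeasurableSpace T] [BorelSpace T]

/-- The function `d x ·` belongs to `L²(μ)`. -/
lemma memLp_dist (μ : Measure T) [IsFiniteMeasure μ] (d : MetricSpace T)
    (hd : d.toPseudoMetricSpace.toUniformSpace.toTopologicalSpace = t) (x : T) :
    MemLp (fun y => d.dist x y) 2 μ := by
  have hc : Continuous fun y => d.dist x y :=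
    (continuous_metric_dist d hd).comp (Continuous.prodMk_right x)
  obtain ⟨C, hC⟩ := isCompact_univ.exists_bound_of_continuousOn hc.continuousOn
  exact MemLp.of_bound hc.measurable.aestronglyMeasurable C
    (Eventually.of_forall fun y => hC y (Set.mem_univ y))

/-- Fourier coefficients of `d(x,·)` are thus values of `D g` at the exact point `x`. -/
lemma inner_toLp_dist (μ : Measure T) [IsFiniteMeasure μ] (d : MetricSpace T)
    (hd : d.toPseudoMetricSpace.toUniformSpace.toTopologicalSpace = t) (x : T) (g : Lp ℝ 2 μ) :
    inner ℝ g ((memLp_dist μ d hd x).toLp _) = distKernelOp d μ g x := by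
  rw [L2.inner_def]
  refine integral_congr_ae ?_
  filter_upwards [(memLp_dist μ d hd x).coeFn_toLp] with y hy
  rw [hy]
  simp [mul_comm]

lemma continuous_distKernelOp (μ : Measure T) [IsFiniteMeasure μ] (d : MetricSpace T)
    (hd : d.toPseudoMetricSpace.toUniformSpace.toTopologicalSpace = t) (g : Lp ℝ 2 μ) :
    Continuous (distKernelOp d μ g) := by
  have hc := continuous_metric_dist d hd
  have : FirstCountableTopology T := by subst hd; infer_instance
  obtain ⟨C, hC⟩ := isCompact_univ.exists_bound_of_continuousOn hc.continuousOn
  have hg : Integrable g μ := (Lp.memLp g).integrable (by norm_num)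
  refine continuous_of_dominated (bound := fun y => ‖g y‖ * C) (fun x => ?_) (fun x => ?_)
    (hg.norm.mul_const C) (Eventually.of_forall fun y => ?_)
  · exact hg.aestronglyMeasurable.mul
      (hc.comp (Continuous.prodMk_right x)).measurable.aestronglyMeasurable
  · refine Eventually.of_forall fun y => ?_
    rw [norm_mul]
    exact mul_le_mul_of_nonneg_left (hC (x, y) (Set.mem_univ _)) (norm_nonneg _)
  · exact continuous_const.mul (hc.comp (Continuous.prodMk_left y))

/-- The eigenfunction expansion of `d x ·` converges in measure, for every point `x`. -/
lemma IsDistKernelEigensystem.tendstoInMeasure (μ : Measure T) [IsFiniteMeasure μ]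
    [μ.IsOpenPosMeasure] (d : MetricSpace T)
    (hd : d.toPseudoMetricSpace.toUniformSpace.toTopologicalSpace = t)
    {lam : ℕ → ℝ} {φ : ℕ → T → ℝ} (H : IsDistKernelEigensystem d μ lam φ) (x : T) :
    TendstoInMeasure μ (fun N y => ∑ n ∈ Finset.range N, lam n * φ n x * φ n y) atTop
      (fun y => d.dist x y) := by
  obtain ⟨K, b, hb, hK⟩ := H.basis
  set v : Lp ℝ 2 μ := (memLp_dist μ d hd x).toLp _ with hv
  have hcoef_inl (n : {n : ℕ // lam n ≠ 0}) : b.repr v (Sum.inl n) = lam n * φ n x := by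
    rw [b.repr_apply_apply, hv, inner_toLp_dist μ d hd, ← H.eigen]
    refine integral_congr_ae ?_
    filter_upwards [hb n] with y hy
    rw [hy]
  have hcoef_inr (k : K) : b.repr v (Sum.inr k) = 0 := by
    rw [b.repr_apply_apply, hv, inner_toLp_dist μ d hd]
    -- `D k` vanishes only a.e. by hypothesis; being continuous, it vanishes at the given `x`
    -- because `μ` charges open sets.
    exact congrFun (((continuous_distKernelOp μ d hd _).ae_eq_iff_eq μ continuous_zero).1 (hK k)) x
  -- Padding by zero indexes the series by `ℕ`, so that its partial sums run over `Finset.range N`.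
  let g : ℕ → Lp ℝ 2 μ := fun n =>
    if h : lam n ≠ 0 then (lam n * φ n x) • b (Sum.inl ⟨n, h⟩) else 0
  have hsub : HasSum (fun n : {n : ℕ // lam n ≠ 0} => g n) v := by
    have h := b.hasSum_repr v
    rw [← Sum.inl_injective.hasSum_iff] at h
    · convert h using 2 with n
      simp [g, n.2, hcoef_inl]
    · rintro (n | k) hn
      · exact absurd ⟨n, rfl⟩ hn
      · simp [hcoef_inr]
  have hsum : HasSum g v := by
    refine (Subtype.val_injective.hasSum_iff fun n hn => ?_).1 hsub
    have : ¬ lam n ≠ 0 := fun h => hn ⟨⟨n, h⟩, rfl⟩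
    simp only [g, dif_neg this]
  have hg (n : ℕ) : g n =ᵐ[μ] fun y => lam n * φ n x * φ n y := by
    by_cases h : lam n ≠ 0
    · simp only [g, dif_pos h]
      filter_upwards [Lp.coeFn_smul (lam n * φ n x) (b (Sum.inl ⟨n, h⟩)), hb ⟨n, h⟩] with y h1 h2
      rw [h1, Pi.smul_apply, h2, smul_eq_mul]
    · simp only [g, dif_neg h]
      filter_upwards [Lp.coeFn_zero ℝ 2 μ] with y h1
      rw [h1, not_not.1 h]
      simp
  refine (tendstoInMeasure_of_tendsto_Lp hsum.tendsto_sum_nat).congr (fun N => ?_)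
    (memLp_dist μ d hd x).coeFn_toLp
  filter_upwards [Lp.coeFn_finsetSum (Finset.range N) g, ae_all_iff.2 hg] with y h1 h2
  rw [h1, Finset.sum_apply]
  exact Finset.sum_congr rfl fun n _ => h2 n

end Expansion

theorem lemma6p1 {T : Type*} [t : TopologicalSpace T] [CompactSpace T]
    [MeasurableSpace T] [BorelSpace T]
    (μ μ' : Measure T) [μ.Regular] [μ'.Regular] [μ.IsOpenPosMeasure] [μ'.IsOpenPosMeasure]
    (hμ : μ ≪ μ')
    (d d' : MetricSpace T)
    (hd : d.toPseudoMetricSpace.toUniformSpace.toTopologicalSpace = t)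
    (hd' : d'.toPseudoMetricSpace.toUniformSpace.toTopologicalSpace = t)
    (Φ Φ' : T → ℕ → ℂ)
    (hΦ : IsDistKernelEmbedding d μ Φ) (hΦ' : IsDistKernelEmbedding d' μ' Φ')
    (h : Φ = Φ') :
    ∀ x y : T, d.dist x y = d'.dist x y := by
  intro x
  subst h
  obtain ⟨lam, φ, H, hφ⟩ := hΦ
  obtain ⟨lam', φ', H', hφ'⟩ := hΦ'
  have hterm (n : ℕ) (y : T) : lam n * φ n x * φ n y = lam' n * φ' n x * φ' n y := by
    have h1 : Φ x n * Φ y n = ((lam n * φ n x * φ n y : ℝ) : ℂ) := by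
      rw [hφ, hφ, mul_mul_mul_comm, realCSqrt_mul_self]
      push_cast
      ring
    have h2 : Φ x n * Φ y n = ((lam' n * φ' n x * φ' n y : ℝ) : ℂ) := by
      rw [hφ', hφ', mul_mul_mul_comm, realCSqrt_mul_self]
      push_cast
      ring
    exact Complex.ofReal_injective (h1.symm.trans h2)
  have hlim := H.tendstoInMeasure μ d hd x
  have hlim' := H'.tendstoInMeasure μ' d' hd' x
  simp only [← hterm] at hlim'
  -- Extract for `μ'` first: a.e. convergence passes from `μ'` to `μ`, and survives the second
  -- extraction.
  obtain ⟨ns, hns, hae⟩ := hlim'.exists_seq_tendsto_ae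
  obtain ⟨ms, hms, hae'⟩ := (hlim.comp hns.tendsto_atTop).exists_seq_tendsto_ae
  have heq : (fun y => d.dist x y) =ᵐ[μ] fun y => d'.dist x y := by
    filter_upwards [hμ.ae_le hae, hae'] with y h1 h2
    exact tendsto_nhds_unique h2 (h1.comp hms.tendsto_atTop)
  have hcont := (continuous_metric_dist d hd).comp (Continuous.prodMk_right x)
  have hcont' := (continuous_metric_dist d' hd').comp (Continuous.prodMk_right x)
  exact congrFun ((hcont.ae_eq_iff_eq μ hcont').1 heq)
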